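/- Let $n\ge 0$, let $M$ be an oriented smooth Riemannian manifold of dimension $n+1$ with Levi-Civita connection $\nabla$, and let $\pi:TM\to M$ be its tangent bundle. For $u\in TM$ let $V_u=\ker d\pi_u\cong T_{\pi(u)}M$ be the vertical space and $H_u$ the horizontal space of $\nabla$, so that $T_u(TM)=H_u\oplus V_u$ with $H_u\cong T_{\pi(u)}M$ through $d\pi_u$; let $w\mapsto w^v$ denote the vertical part, regarded as an element of $T_{\pi(u)}M$. Let $B$ be the endomorphism of $T(TM)$ that vanishes on $V$ and maps $H$ to $V$ through $H\cong\pi^*TM\cong V$, and let $\xi$ be the canonical vertical vector field, $\xi_u=u\in V_u$. On the unit tangent sphere bundle $SM_1=\{u\in TM:\|u\|=1\}$ consider the $n$-form $\alpha=\frac{\xi}{\|\xi\|}\lrcorner\,\pi^{-1}\mathrm{vol}_M$, that is $\alpha(w_1,\dots,w_n)=\mathrm{vol}_M(u/\|u\|,w_1^v,\dots,w_n^v)$ at $u$, and, for $0\le i\le n$, the $n$-form $$\alpha_i(w_1,\dots,w_n)=\frac1{i!\,(n-i)!}\sum_{\sigma\in S_n}\mathrm{sgn}(\sigma)\,\alpha(Bw_{\sigma_1},\dots,Bw_{\sigma_i},w_{\sigma_{i+1}},\dots,w_{\sigma_n}).$$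 Let $N$ be an oriented smooth Riemannian manifold of dimension $n$, possibly with boundary, and let $f:N\to M$ be a smooth isometric immersion. Let $\vec\nu$ be the unit normal along $f$ chosen according to the orientations: $v_1,\dots,v_n$ is a direct frame of $T_xN$ if and only if $\vec\nu_x,df(v_1),\dots,df(v_n)$ is a direct frame of $T_{f(x)}M$. Let $\hat f:N\to SM_1$, $\hat f(x)=\vec\nu_x$, be the corresponding lift of $f$, and let $A=-\nabla\vec\nu:T_xN\to T_xN$ be the second fundamental form (where $\nabla$ acts on sections of $f^*TM$ as the pull-back connection and $T_xN$ is identified with its image under $df$). Let $\sigma_i(A)$ be the elementary symmetric polynomial of degree $i$ in the eigenvalues $\lambda_1,\dots,\lambda_n$ of $A$, counted with multiplicity. Then $\hat f$ is smooth and, for all $0\le i\le n$, $$\hat f^*\alpha_{n-i}=(-1)^i\,\sigma_i(A)\,\mathrm{vol}_N .$$ -/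

import Mathlib

open Bundle Manifold Module Topology
open scoped ContDiff

noncomputable section

namespace Griffiths

/-! ## Tangent spaces of a Riemannian manifold -/

section TangentSpaces

variable {E : Type*} [NormedAddCommGroup E] [NormedSpace ℝ E]
  {H : Type*} [TopologicalSpace H] {I : ModelWithCorners ℝ E H}
  {M : Type*} [TopologicalSpace M] [ChartedSpace H M]

instance tangentSpaceFiniteDimensional [FiniteDimensional ℝ E] (x : M) :
    FiniteDimensional ℝ (TangentSpace I x) :=
  inferInstanceAs (FiniteDimensional ℝ E)

instance tangentSpaceFinrank {m : ℕ} [h : Fact (finrank ℝ E = m)] (x : M) :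
    Fact (finrank ℝ (TangentSpace I x) = m) := h

instance euclideanFinrank (m : ℕ) : Fact (finrank ℝ (EuclideanSpace ℝ (Fin m)) = m) :=
  ⟨finrank_euclideanSpace_fin⟩

end TangentSpaces

/-! ## Orientations -/

section Orientations

variable {E : Type*} [NormedAddCommGroup E] [NormedSpace ℝ E]
  {H : Type*} [TopologicalSpace H] (I : ModelWithCorners ℝ E H)
  (M : Type*) [TopologicalSpace M] [ChartedSpace H M] [IsManifold I 1 M]

/-- An orientation of an `m`-dimensional manifold: an orientation of every tangent space which,
read in the local trivializations of the tangent bundle given by the charts, is locally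
constant. -/
structure ManifoldOrientation (m : ℕ) where
  /-- the orientation of the tangent space at `x` -/
  orient : ∀ x : M, Orientation ℝ (TangentSpace I x) (Fin m)
  locallyConstant : ∀ x₀ : M, ∃ o : Orientation ℝ E (Fin m), ∀ᶠ x in 𝓝 x₀,
    ∀ hx : x ∈ (trivializationAt E (TangentSpace I : M → Type _) x₀).baseSet,
      Orientation.map (Fin m)
        ((trivializationAt E (TangentSpace I : M → Type _) x₀).linearEquivAt ℝ x hx)
        (orient x) = o

end Orientations

/-! ## Connections -/

section Connections

variable {E : Type*} [NormedAddCommGroup E] [NormedSpace ℝ E] [FiniteDimensional ℝ E]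
  {H : Type*} [TopologicalSpace H] {I : ModelWithCorners ℝ E H}
  {M : Type*} [TopologicalSpace M] [ChartedSpace H M] [IsManifold I ∞ M]

/-- The Levi-Civita connection: the torsion-free connection compatible with the metric. -/
structure IsLeviCivita [RiemannianBundle (fun x : M ↦ TangentSpace I x)]
    [IsContMDiffRiemannianBundle I ∞ E (fun x : M ↦ TangentSpace I x)]
    (cov : CovariantDerivative I E (fun x : M ↦ TangentSpace I x)) : Prop where
  torsion_eq_zero : cov.torsion = 0
  metric : (CovariantDerivative.IsMetricCompatible (I := I) (F := E)
    (V := fun x : M ↦ TangentSpace I x) ·) cov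

variable {E' : Type*} [NormedAddCommGroup E'] [NormedSpace ℝ E']
  {H' : Type*} [TopologicalSpace H'] (J : ModelWithCorners ℝ E' H')
  {P : Type*} [TopologicalSpace P] [ChartedSpace H' P]

/-- The pull-back connection `f^*∇` on `f^*TM`, for a map `f : P → M`: if `(e_j)` is the frame of
`TM` near `f x` given by the trivialization at `f x`, and `s = ∑ s^j e_j ∘ f`, then
`(f^*∇)_w s = ∑ ds^j(w) e_j + ∇_{df(w)} (∑ s^j(x) e_j)`. -/
def pullbackConnection (cov : CovariantDerivative I E (fun x : M ↦ TangentSpace I x))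
    (f : P → M) (s : ∀ y : P, TangentSpace I (f y)) (x : P) :
    TangentSpace J x →L[ℝ] TangentSpace I (f x) :=
  let e := trivializationAt E (TangentSpace I : M → Type _) (f x)
  (e.symmL ℝ (f x)).comp
      (mfderiv J 𝓘(ℝ, E) (fun y ↦ (e ⟨f y, s y⟩).2) x : TangentSpace J x →L[ℝ] E)
    + (cov (FiberBundle.extend E (s x)) (f x)).comp (mfderiv J I f x)

end Connections

/-! ## Geometry of the tangent bundle and the Griffiths forms -/

section TangentBundleGeometry

variable {E : Type*} [NormedAddCommGroup E] [NormedSpace ℝ E] [FiniteDimensional ℝ E]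
  {H : Type*} [TopologicalSpace H] {I : ModelWithCorners ℝ E H}
  {M : Type*} [TopologicalSpace M] [ChartedSpace H M] [IsManifold I ∞ M]
  (cov : CovariantDerivative I E (fun x : M ↦ TangentSpace I x))

/-- The differential of the projection `π : TM → M`. -/
def dproj (u : TangentBundle I M) : TangentSpace I.tangent u →L[ℝ] TangentSpace I u.proj :=
  mfderiv I.tangent I (fun v : TangentBundle I M ↦ v.proj) u

/-- The inclusion of the fibre `T_pM` in `TM`. The vector space `T_pM`, as a manifold, is the model
space `E`. -/
def fiberInclusion (p : M) (z : E) : TangentBundle I M :=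
  ⟨p, (z : TangentSpace I p)⟩

/-- The canonical isomorphism of `T_{π(u)}M` with the vertical space `V_u = ker dπ_u ⊆ T_u(TM)`:
the differential at `u` of the inclusion of the fibre `T_{π(u)}M` in `TM`. -/
def vertLift (u : TangentBundle I M) : TangentSpace I u.proj →L[ℝ] TangentSpace I.tangent u :=
  mfderiv 𝓘(ℝ, E) I.tangent (fiberInclusion (I := I) u.proj) (u.snd : E)

/-- The vertical part of a tangent vector of `TM`, as an element of `π^*TM ≃ V`:
`w ↦ ∇^*_w ξ`, where `∇^* = π^*∇` and `ξ_u = u` is the canonical section of `π^*TM`. Its kernel is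
the horizontal space of the connection. -/
def vertPart (u : TangentBundle I M) : TangentSpace I.tangent u →L[ℝ] TangentSpace I u.proj :=
  pullbackConnection I.tangent cov (fun v : TangentBundle I M ↦ v.proj) (fun v ↦ v.snd) u

/-- The endomorphism `B` of `T_u(TM) = H_u ⊕ V_u` which vanishes on `V_u` and maps `H_u` to `V_u`
through `H_u ≃ T_{π(u)}M ≃ V_u`. -/
def mirror (u : TangentBundle I M) :
    TangentSpace I.tangent u →L[ℝ] TangentSpace I.tangent u :=
  (vertLift u).comp (dproj u)

/-- The canonical vertical vector field `ξ` on `TM`. -/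
def canonicalField (u : TangentBundle I M) : TangentSpace I.tangent u :=
  vertLift u u.snd

variable [RiemannianBundle (fun x : M ↦ TangentSpace I x)]

variable (I M) in
/-- The unit tangent sphere bundle `SM_1`, as a subset of `TM`. -/
def unitSphereBundle : Set (TangentBundle I M) := {u | ‖u.snd‖ = 1}

variable {n : ℕ} [Fact (finrank ℝ E = n + 1)] (oM : ManifoldOrientation I M (n + 1))

/-- The `n`-form `α = (ξ/‖ξ‖) ⌟ π^{-1}vol_M`, where `π^{-1}vol_M` is the vertical pull-back of the
volume form of `M`. -/
def alphaForm (u : TangentBundle I M) : TangentSpace I.tangent u [⋀^Fin n]→ₗ[ℝ] ℝ :=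
  ((oM.orient u.proj).volumeForm.compLinearMap (vertPart cov u).toLinearMap).curryLeft
    (‖u.snd‖⁻¹ • canonicalField u)

/-- The Griffiths form `α_i`, `0 ≤ i ≤ n`:
`α_i(v_1,…,v_n) = 1/(i!(n-i)!) ∑_σ sgn(σ) α(B v_{σ 1},…,B v_{σ i}, v_{σ (i+1)},…,v_{σ n})`.
It is given at the points of `SM_1` as a form on the whole of `T_u(TM)`, which contains
`T_u(SM_1)`. -/
def griffithsForm (i : ℕ) (u : unitSphereBundle I M) :
    TangentSpace I.tangent u.1 [⋀^Fin n]→ₗ[ℝ] ℝ :=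
  (1 / ((i.factorial : ℝ) * ((n - i).factorial : ℝ))) •
    MultilinearMap.alternatization
      ((alphaForm cov oM u.1).toMultilinearMap.compLinearMap
        (fun j : Fin n ↦ if (j : ℕ) < i then (mirror u.1).toLinearMap else LinearMap.id))

end TangentBundleGeometry

/-! ## Hypersurfaces -/

section Hypersurfaces

variable {E : Type*} [NormedAddCommGroup E] [NormedSpace ℝ E] [FiniteDimensional ℝ E]
  {H : Type*} [TopologicalSpace H] (I : ModelWithCorners ℝ E H)
  {M : Type*} [TopologicalSpace M] [ChartedSpace H M] [IsManifold I ∞ M]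
  [RiemannianBundle (fun x : M ↦ TangentSpace I x)]
  {E' : Type*} [NormedAddCommGroup E'] [NormedSpace ℝ E'] [FiniteDimensional ℝ E']
  {H' : Type*} [TopologicalSpace H'] (J : ModelWithCorners ℝ E' H')
  {N : Type*} [TopologicalSpace N] [ChartedSpace H' N] [IsManifold J ∞ N]
  [RiemannianBundle (fun x : N ↦ TangentSpace J x)]

/-- Smooth isometric immersions. -/
structure IsIsometricImmersion (f : N → M) : Prop where
  contMDiff : ContMDiff J I ∞ f
  inner_eq : ∀ (x : N) (v w : TangentSpace J x),
    inner ℝ (mfderiv J I f x v) (mfderiv J I f x w) = inner ℝ v w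

variable {I J}
variable {n : ℕ} [Fact (finrank ℝ E = n + 1)] [Fact (finrank ℝ E' = n)]

/-- `ν` is the unit normal along `f : N → M` determined by the orientations of `N` and `M`:
`v_1, …, v_n` is a direct frame of `T_xN` if and only if `ν_x, df(v_1), …, df(v_n)` is a direct
frame of `T_{f(x)}M`. -/
structure IsOrientedUnitNormal (oM : ManifoldOrientation I M (n + 1))
    (oN : ManifoldOrientation J N n) (f : N → M) (ν : ∀ x : N, TangentSpace I (f x)) : Prop where
  norm_eq_one : ∀ x, ‖ν x‖ = 1
  normal : ∀ (x : N) (w : TangentSpace J x), inner ℝ (ν x) (mfderiv J I f x w) = 0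
  direct : ∀ (x : N) (v : Fin n → TangentSpace J x),
    0 < (oM.orient (f x)).volumeForm (Fin.cons (ν x) (fun j ↦ mfderiv J I f x (v j))) ↔
      0 < (oN.orient x).volumeForm v

/-- The lift `f̂ : N → SM_1`, `f̂(x) = ν_x`, of a map `f : N → M` given by a unit vector field
`ν` along `f`. -/
def lift (f : N → M) (ν : ∀ x : N, TangentSpace I (f x)) (hν : ∀ x, ‖ν x‖ = 1) (x : N) :
    unitSphereBundle I M :=
  ⟨⟨f x, ν x⟩, hν x⟩

variable (I J) in
/-- The pull-back by a map `F : N → SM_1` of a field of `n`-forms. Since `SM_1` is an embedded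
submanifold of `TM`, the differential of `F` is that of `F` regarded as a map into `TM`. -/
def pullbackForm (F : N → unitSphereBundle I M)
    (η : ∀ u : unitSphereBundle I M, TangentSpace I.tangent u.1 [⋀^Fin n]→ₗ[ℝ] ℝ) (x : N) :
    TangentSpace J x [⋀^Fin n]→ₗ[ℝ] ℝ :=
  (η (F x)).compLinearMap
    (mfderiv J I.tangent (fun y ↦ (F y : TangentBundle I M)) x).toLinearMap

variable (J) in
/-- The second fundamental form `A = -∇ν : T_xN → T_xN`, where `T_xN` is identified with its image
by `df`; for an isometric immersion the adjoint of `df` is the tangential projection followed by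
the inverse of `df`. -/
def secondFundamentalForm (cov : CovariantDerivative I E (fun x : M ↦ TangentSpace I x))
    (f : N → M) (ν : ∀ x : N, TangentSpace I (f x)) (x : N) :
    TangentSpace J x →ₗ[ℝ] TangentSpace J x :=
  -((mfderiv J I f x).toLinearMap.adjoint ∘ₗ (pullbackConnection J cov f ν x).toLinearMap)

end Hypersurfaces

/-- The elementary symmetric polynomial of degree `i` in the eigenvalues of `A`, counted with
multiplicity. -/
def sigma {V : Type*} [AddCommGroup V] [Module ℝ V] [FiniteDimensional ℝ V]
    (i : ℕ) (A : V →ₗ[ℝ] V) : ℝ :=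
  A.charpoly.roots.esymm i

end Griffiths

end

noncomputable section

namespace Griffiths

/-- Two finite sets of the same size are related by a permutation. -/
theorem exists_perm_map_eq {α : Type*} [Fintype α] [DecidableEq α] {s t : Finset α}
    (h : s.card = t.card) : ∃ τ : Equiv.Perm α, s.map τ.toEmbedding = t := by
  let e : {x // x ∈ s} ≃ {x // x ∈ t} := Finset.equivOfCardEq h
  refine ⟨e.extendSubtype, ?_⟩
  refine Finset.eq_of_subset_of_card_le (fun x hx ↦ ?_) (by simp [h])
  obtain ⟨y, hy, rfl⟩ := Finset.mem_map.1 hx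
  exact e.extendSubtype_mem y hy

/-- The number of permutations which map `s` onto `t`. -/
theorem card_filter_perm_map_eq {α : Type*} [Fintype α] [DecidableEq α] {s t : Finset α}
    (h : s.card = t.card) :
    (Finset.univ.filter fun σ : Equiv.Perm α ↦ s.map σ.toEmbedding = t).card =
      s.card.factorial * (Fintype.card α - s.card).factorial := by
  have key : ∀ t' ∈ Finset.powersetCard s.card (Finset.univ : Finset α),
      (Finset.univ.filter fun σ : Equiv.Perm α ↦ s.map σ.toEmbedding = t').card =
        (Finset.univ.filter fun σ : Equiv.Perm α ↦ s.map σ.toEmbedding = t).card := by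
    intro t' ht'
    obtain ⟨τ, hτ⟩ := exists_perm_map_eq ((Finset.mem_powersetCard.1 ht').2.trans h)
    refine Finset.card_bij (fun σ _ ↦ τ * σ) (fun σ hσ ↦ ?_) (fun _ _ _ _ h ↦ mul_left_cancel h)
      fun σ hσ ↦ ⟨τ⁻¹ * σ, ?_, mul_inv_cancel_left τ σ⟩
    · simp only [Finset.mem_filter, Finset.mem_univ, true_and] at hσ ⊢
      rw [← hτ, ← hσ, Finset.map_map]
      rfl
    · simp only [Finset.mem_filter, Finset.mem_univ, true_and] at hσ ⊢
      apply Finset.map_injective τ.toEmbedding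
      rw [hτ, ← hσ, Finset.map_map]
      congr 1
      ext x
      simp
  have hsum := Finset.card_eq_sum_card_fiberwise
    (f := fun σ : Equiv.Perm α ↦ s.map σ.toEmbedding) (s := Finset.univ)
    (t := Finset.powersetCard s.card Finset.univ) (by intro σ _; simp [Finset.mem_powersetCard])
  rw [Finset.sum_congr rfl key, Finset.sum_const, Finset.card_powersetCard, Finset.card_univ,
    Fintype.card_perm, Finset.card_univ, smul_eq_mul,
    ← Nat.choose_mul_factorial_mul_factorial s.card_le_univ, mul_assoc] at hsum
  exact (Nat.eq_of_mul_eq_mul_left (Nat.choose_pos s.card_le_univ) hsum).symm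

/-- The sum over all permutations `σ` of a function of `σ s`. -/
theorem sum_perm_map {α R : Type*} [Fintype α] [DecidableEq α] [CommSemiring R] (s : Finset α)
    (F : Finset α → R) :
    ∑ σ : Equiv.Perm α, F (s.map σ.toEmbedding) =
      (s.card.factorial * (Fintype.card α - s.card).factorial : ℕ) *
        ∑ t ∈ Finset.powersetCard s.card Finset.univ, F t := by
  rw [← Finset.sum_fiberwise_of_maps_to (s := Finset.univ)
    (t := Finset.powersetCard s.card Finset.univ)
    (g := fun σ : Equiv.Perm α ↦ s.map σ.toEmbedding) (by intro σ _; simp [Finset.mem_powersetCard]),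
    Finset.mul_sum]
  refine Finset.sum_congr rfl fun t ht ↦ ?_
  rw [Finset.sum_congr rfl (g := fun _ ↦ F t) (by intro σ hσ; rw [(Finset.mem_filter.1 hσ).2]),
    Finset.sum_const, card_filter_perm_map_eq (Finset.mem_powersetCard.1 ht).2.symm, nsmul_eq_mul]

/-- Antisymmetrizing `η(w_1,…,w_k,-A w_{k+1},…,-A w_n)` gives an elementary symmetric polynomial in
the eigenvalues of `A`. -/
theorem alternatization_compLinearMap_neg {V : Type*} [NormedAddCommGroup V]
    [InnerProductSpace ℝ V] [FiniteDimensional ℝ V] {n : ℕ} (hn : finrank ℝ V = n)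
    {A : V →ₗ[ℝ] V} (hA : A.IsSymmetric) (η : V [⋀^Fin n]→ₗ[ℝ] ℝ) {k : ℕ} (hk : k ≤ n) :
    (1 / ((k.factorial : ℝ) * ((n - k).factorial : ℝ))) •
        MultilinearMap.alternatization (η.toMultilinearMap.compLinearMap
          (fun j : Fin n ↦ if (j : ℕ) < k then LinearMap.id else -A)) =
      ((-1) ^ (n - k) * sigma (n - k) A) • η := by
  set b := (hA.eigenvectorBasis hn).toBasis with hb
  set l := hA.eigenvalues hn with hl
  have hAb : ∀ j, A (b j) = l j • b j := fun j ↦ by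
    simp [hb, hl]
  suffices h : MultilinearMap.alternatization (η.toMultilinearMap.compLinearMap
      (fun j : Fin n ↦ if (j : ℕ) < k then LinearMap.id else -A)) b =
      (k.factorial * (n - k).factorial : ℝ) * ((-1) ^ (n - k) * sigma (n - k) A) * η b by
    rw [AlternatingMap.eq_smul_basis_det b (_ • MultilinearMap.alternatization _),
      AlternatingMap.eq_smul_basis_det b ((_ : ℝ) • η)]
    congr 1
    rw [AlternatingMap.smul_apply, AlternatingMap.smul_apply, h, smul_eq_mul, smul_eq_mul]
    have : (k.factorial * (n - k).factorial : ℝ) ≠ 0 := by positivity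
    field_simp
  set T : Finset (Fin n) := Finset.univ.filter fun j ↦ ¬ (j : ℕ) < k with hT
  have hTc : T.card = n - k := by
    have h1 := Finset.card_filter_add_card_filter_not (s := (Finset.univ : Finset (Fin n)))
      (fun j ↦ (j : ℕ) < k)
    rw [Finset.card_univ, Fintype.card_fin, Fin.card_filter_val_lt, min_eq_right hk] at h1
    rw [hT]
    omega
  have hterm : ∀ σ : Equiv.Perm (Fin n),
      Equiv.Perm.sign σ • (η.toMultilinearMap.compLinearMap
        (fun j : Fin n ↦ if (j : ℕ) < k then LinearMap.id else -A)).domDomCongr σ b =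
      (∏ j ∈ T.map σ.toEmbedding, -l j) * η b := by
    intro σ
    have hv : (fun j : Fin n ↦ (if (j : ℕ) < k then LinearMap.id else -A) (b (σ j))) =
        fun j : Fin n ↦ (if (j : ℕ) < k then (1 : ℝ) else -l (σ j)) • b (σ j) := by
      ext j
      split_ifs <;> simp [hAb]
    rw [MultilinearMap.domDomCongr_apply, MultilinearMap.compLinearMap_apply, hv,
      MultilinearMap.map_smul_univ]
    have hperm : η.toMultilinearMap (fun j ↦ b (σ j)) = Equiv.Perm.sign σ • η b :=
      η.map_perm b σ
    rw [hperm, smul_comm, smul_smul, Int.units_mul_self, one_smul, smul_eq_mul, Finset.prod_map,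
      hT, Finset.prod_filter]
    congr 1
    refine Finset.prod_congr rfl fun j _ ↦ ?_
    by_cases hj : (j : ℕ) < k <;> simp [hj]
  rw [MultilinearMap.alternatization_apply, Finset.sum_congr rfl fun σ _ ↦ hterm σ,
    ← Finset.sum_mul, sum_perm_map T (fun s ↦ ∏ j ∈ s, -l j), hTc, Fintype.card_fin,
    Nat.sub_sub_self hk]
  have hs : sigma (n - k) A = ∑ t ∈ Finset.powersetCard (n - k) Finset.univ, ∏ j ∈ t, l j := by
    rw [sigma, hA.roots_charpoly_eq_eigenvalues hn]
    exact Finset.esymm_map_val _ _ _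
  have hneg : ∑ t ∈ Finset.powersetCard (n - k) Finset.univ, ∏ j ∈ t, -l j =
      (-1) ^ (n - k) * ∑ t ∈ Finset.powersetCard (n - k) Finset.univ, ∏ j ∈ t, l j := by
    rw [Finset.mul_sum]
    refine Finset.sum_congr rfl fun t ht ↦ ?_
    rw [Finset.prod_neg, (Finset.mem_powersetCard.1 ht).2]
  rw [hs, hneg, Nat.cast_mul, mul_comm (k.factorial : ℝ)]

section Projections

variable {E : Type*} [NormedAddCommGroup E] [NormedSpace ℝ E]
  {H : Type*} [TopologicalSpace H] {I : ModelWithCorners ℝ E H}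
  {M : Type*} [TopologicalSpace M] [ChartedSpace H M] [IsManifold I ∞ M]
  {E' : Type*} [NormedAddCommGroup E'] [NormedSpace ℝ E']
  {H' : Type*} [TopologicalSpace H'] {J : ModelWithCorners ℝ E' H'}
  {P : Type*} [TopologicalSpace P] [ChartedSpace H' P]

theorem dproj_mfderiv {F : P → TangentBundle I M} {x : P}
    (hF : MDifferentiableAt J I.tangent F x) (w : TangentSpace J x) :
    dproj (F x) (mfderiv J I.tangent F x w) = mfderiv J I (fun y ↦ (F y).proj) x w :=
  congrArg (fun L ↦ L w)
    (mfderiv_comp x (mdifferentiableAt_proj (TangentSpace I : M → Type _)) hF).symm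

theorem mdifferentiableAt_trivializationAt_snd (u : TangentBundle I M) :
    MDifferentiableAt I.tangent 𝓘(ℝ, E)
      (fun v : TangentBundle I M ↦
        (trivializationAt E (TangentSpace I : M → Type _) u.proj v).2) u :=
  ((mdifferentiableAt_totalSpace I (fun v : TangentBundle I M ↦ v)).1 mdifferentiableAt_id).2

variable (I) in
theorem hasMFDerivAt_trivializationAt_fiberInclusion (p : M) (z : E) :
    HasMFDerivAt 𝓘(ℝ, E) 𝓘(ℝ, E) (fun y : E ↦
        (trivializationAt E (TangentSpace I : M → Type _) p (fiberInclusion (I := I) p y)).2) z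
      ((trivializationAt E (TangentSpace I : M → Type _) p).continuousLinearMapAt ℝ p) := by
  have h : (fun y : E ↦
      (trivializationAt E (TangentSpace I : M → Type _) p (fiberInclusion (I := I) p y)).2) =
      ((trivializationAt E (TangentSpace I : M → Type _) p).continuousLinearMapAt ℝ p :
        E →L[ℝ] E) := by
    ext y
    rw [Trivialization.continuousLinearMapAt_apply,
      Trivialization.coe_linearMapAt_of_mem _ (FiberBundle.mem_baseSet_trivializationAt' _)]
    rfl
  rw [h]
  exact ContinuousLinearMap.hasMFDerivAt _

theorem mdifferentiableAt_fiberInclusion (p : M) (z : E) :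
    MDifferentiableAt 𝓘(ℝ, E) I.tangent (fiberInclusion (I := I) p) z := by
  rw [mdifferentiableAt_totalSpace]
  exact ⟨mdifferentiableAt_const,
    (hasMFDerivAt_trivializationAt_fiberInclusion I p z).mdifferentiableAt⟩

theorem dproj_mfderiv_fiberInclusion (p : M) (z v : E) :
    dproj (fiberInclusion (I := I) p z)
      (mfderiv 𝓘(ℝ, E) I.tangent (fiberInclusion (I := I) p) z v) = 0 :=
  (dproj_mfderiv (mdifferentiableAt_fiberInclusion p z) v).trans
    (congrArg (fun L ↦ L v) (mfderiv_const (I := 𝓘(ℝ, E)) (I' := I) (M := E) (c := p) (x := z)))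

variable (cov : CovariantDerivative I E (fun x : M ↦ TangentSpace I x))

theorem pullbackConnection_apply (f : P → M) (s : ∀ y : P, TangentSpace I (f y)) (x : P)
    (w : TangentSpace J x) :
    pullbackConnection J cov f s x w =
      (trivializationAt E (TangentSpace I : M → Type _) (f x)).symmL ℝ (f x)
        (mfderiv J 𝓘(ℝ, E)
          (fun y ↦ (trivializationAt E (TangentSpace I : M → Type _) (f x) ⟨f y, s y⟩).2) x w) +
      cov (FiberBundle.extend E (s x)) (f x) (mfderiv J I f x w) :=
  rfl

theorem vertPart_mfderiv {F : P → TangentBundle I M} {x : P}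
    (hF : MDifferentiableAt J I.tangent F x) (w : TangentSpace J x) :
    vertPart cov (F x) (mfderiv J I.tangent F x w) =
      pullbackConnection J cov (fun y ↦ (F y).proj) (fun y ↦ (F y).snd) x w := by
  rw [vertPart, pullbackConnection_apply, pullbackConnection_apply]
  congr 1
  · exact congrArg _ (congrArg (fun L ↦ L w)
      (mfderiv_comp x (mdifferentiableAt_trivializationAt_snd (F x)) hF)).symm
  · exact congrArg _ (dproj_mfderiv hF w)

theorem vertPart_mfderiv_fiberInclusion (p : M) (z v : E) :
    vertPart cov (fiberInclusion (I := I) p z)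
      (mfderiv 𝓘(ℝ, E) I.tangent (fiberInclusion (I := I) p) z v) = v := by
  have h1 := (mfderiv_comp z
    (mdifferentiableAt_trivializationAt_snd (fiberInclusion (I := I) p z))
    (mdifferentiableAt_fiberInclusion p z)).symm.trans
    (hasMFDerivAt_trivializationAt_fiberInclusion I p z).mfderiv
  rw [vertPart, pullbackConnection_apply]
  refine (congrArg₂ _ (congrArg _ (congrArg (fun L ↦ L v) h1))
    (congrArg _ (dproj_mfderiv_fiberInclusion (I := I) p z v))).trans ?_
  rw [map_zero, add_zero]
  exact Trivialization.symmL_continuousLinearMapAt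
    (trivializationAt E (TangentSpace I : M → Type _) p)
    (FiberBundle.mem_baseSet_trivializationAt' p) v

theorem vertPart_vertLift (u : TangentBundle I M) (v : TangentSpace I u.proj) :
    vertPart cov u (vertLift u v) = v :=
  vertPart_mfderiv_fiberInclusion (E := E) cov u.proj u.snd v

end Projections

section ProductRule

variable {E' : Type*} [NormedAddCommGroup E'] [NormedSpace ℝ E']
  {H' : Type*} [TopologicalSpace H'] {J : ModelWithCorners ℝ E' H'}
  {P : Type*} [TopologicalSpace P] [ChartedSpace H' P]
  {F G : Type*} [NormedAddCommGroup F] [NormedSpace ℝ F] [NormedAddCommGroup G] [NormedSpace ℝ G]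

theorem mvfderiv_clm_apply {L : P → F →L[ℝ] G} {v : P → F} {x : P}
    (hL : MDifferentiableAt J 𝓘(ℝ, F →L[ℝ] G) L x) (hv : MDifferentiableAt J 𝓘(ℝ, F) v x)
    (w : TangentSpace J x) :
    mvfderiv J (fun y ↦ L y (v y)) x w =
      mvfderiv J L x w (v x) + L x (mvfderiv J v x w) := by
  have h1 := hL.hasMFDerivAt
  have h2 := hv.hasMFDerivAt
  simp only [HasMFDerivAt, writtenInExtChartAt, mfld_simps] at h1 h2
  have h3 := h1.2.clm_apply h2.2
  have h4 : HasMFDerivAt J 𝓘(ℝ, G) (fun y ↦ L y (v y)) x _ := 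
    ⟨h1.1.clm_apply h2.1, by simpa only [writtenInExtChartAt, mfld_simps] using! h3⟩
  rw [add_comm, mvfderiv, h4.mfderiv]
  rfl

end ProductRule

section Metric

variable {E : Type*} [NormedAddCommGroup E] [NormedSpace ℝ E]
  {H : Type*} [TopologicalSpace H] (I : ModelWithCorners ℝ E H)
  {M : Type*} [TopologicalSpace M] [ChartedSpace H M] [IsManifold I ∞ M]

theorem trivializationAt_extend (p₀ : M) (v : TangentSpace I p₀) {p : M}
    (hp : p ∈ (trivializationAt E (TangentSpace I : M → Type _) p₀).baseSet) :
    (trivializationAt E (TangentSpace I : M → Type _) p₀ ⟨p, FiberBundle.extend E v p⟩).2 =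
      (trivializationAt E (TangentSpace I : M → Type _) p₀ ⟨p₀, v⟩).2 := by
  rw [FiberBundle.extend, Trivialization.apply_mk_symm _ hp]

variable [RiemannianBundle (fun x : M ↦ TangentSpace I x)]
  [IsContMDiffRiemannianBundle I ∞ E (fun x : M ↦ TangentSpace I x)]

theorem exists_metric_in_trivialization (p₀ : M) :
    ∃ G : M → E →L[ℝ] E →L[ℝ] ℝ, ContMDiffAt I 𝓘(ℝ, E →L[ℝ] E →L[ℝ] ℝ) ∞ G p₀ ∧
      ∀ p ∈ (trivializationAt E (TangentSpace I : M → Type _) p₀).baseSet,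
        ∀ v w : TangentSpace I p, inner ℝ v w =
          G p (trivializationAt E (TangentSpace I : M → Type _) p₀ ⟨p, v⟩).2
            (trivializationAt E (TangentSpace I : M → Type _) p₀ ⟨p, w⟩).2 := by
  obtain ⟨g, hg, hgi⟩ := IsContMDiffRiemannianBundle.exists_contMDiff (IB := I) (n := ∞) (F := E)
    (E := fun x : M ↦ TangentSpace I x)
  have h := (contMDiffAt_hom_bundle _).1 (hg p₀)
  refine ⟨_, h.2, fun p hp v w ↦ ?_⟩
  rw [hgi, inCoordinates_apply_eq₂ hp hp (Set.mem_univ _)]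
  have h1 : ∀ u : TangentSpace I p, (trivializationAt E (TangentSpace I : M → Type _) p₀).symm p
    (trivializationAt E (TangentSpace I : M → Type _) p₀ ⟨p, u⟩).2 = u := fun u ↦
      Trivialization.symm_apply_apply_mk _ hp u
  rw [h1, h1]
  exact (congrArg (fun L ↦ L (g p v w)) (Bundle.Trivial.linearMapAt_trivialization (B := M) (F := ℝ) ℝ p)).symm

variable {I} [FiniteDimensional ℝ E]
  {cov : CovariantDerivative I E (fun x : M ↦ TangentSpace I x)}

theorem mvfderiv_inner_extend
    (hcov : (CovariantDerivative.IsMetricCompatible (I := I) (F := E)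
      (V := fun x : M ↦ TangentSpace I x) ·) cov) (p : M) (a b v : TangentSpace I p) :
    mvfderiv I (fun q ↦ (inner ℝ (FiberBundle.extend E a q : TangentSpace I q)
        (FiberBundle.extend E b q : TangentSpace I q) : ℝ)) p v =
      inner ℝ (cov (FiberBundle.extend E a) p v) b +
        inner ℝ a (cov (FiberBundle.extend E b) p v) := by
  have h := CovariantDerivative.IsMetricCompatible.mvfderiv_inner_eq (I := I) (F := E)
      (V := fun x : M ↦ TangentSpace I x) hcov (x := p) (FiberBundle.extend E v)
      (FiberBundle.mdifferentiableAt_extend I E a) (FiberBundle.mdifferentiableAt_extend I E b)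
  simp only [FiberBundle.extend_apply_self] at h
  exact h

theorem mvfderiv_inner_eq_pullbackConnection
    (hcov : (CovariantDerivative.IsMetricCompatible (I := I) (F := E)
      (V := fun x : M ↦ TangentSpace I x) ·) cov)
    {E' : Type*} [NormedAddCommGroup E'] [NormedSpace ℝ E']
    {H' : Type*} [TopologicalSpace H'] {J : ModelWithCorners ℝ E' H'}
    {P : Type*} [TopologicalSpace P] [ChartedSpace H' P]
    {f : P → M} {s t : ∀ y : P, TangentSpace I (f y)} {x : P}
    (hs : MDifferentiableAt J I.tangent (fun y ↦ (⟨f y, s y⟩ : TangentBundle I M)) x)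
    (ht : MDifferentiableAt J I.tangent (fun y ↦ (⟨f y, t y⟩ : TangentBundle I M)) x)
    (w : TangentSpace J x) :
    mvfderiv J (fun y ↦ (inner ℝ (s y) (t y) : ℝ)) x w =
      inner ℝ (pullbackConnection J cov f s x w) (t x) +
        inner ℝ (s x) (pullbackConnection J cov f t x w) := by
  set e := trivializationAt E (TangentSpace I : M → Type _) (f x) with he
  have hb : f x ∈ e.baseSet := FiberBundle.mem_baseSet_trivializationAt' (f x)
  obtain ⟨G, hG, hGi⟩ := exists_metric_in_trivialization I (f x)
  have hG' := hG.mdifferentiableAt (by simp)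
  obtain ⟨hf, hs'⟩ := (mdifferentiableAt_totalSpace I _).1 hs
  have ht' := ((mdifferentiableAt_totalSpace I _).1 ht).2
  change MDifferentiableAt J I f x at hf
  change MDifferentiableAt J 𝓘(ℝ, E) (fun y ↦ (e ⟨f y, s y⟩).2) x at hs'
  change MDifferentiableAt J 𝓘(ℝ, E) (fun y ↦ (e ⟨f y, t y⟩).2) x at ht'
  have hGf : MDifferentiableAt J 𝓘(ℝ, E →L[ℝ] E →L[ℝ] ℝ) (fun y ↦ G (f y)) x := hG'.comp x hf
  have hGfd : mvfderiv J (fun y ↦ G (f y)) x w = mvfderiv I G (f x) (mfderiv J I f x w) :=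
    congrArg (fun L ↦ L w) (mfderiv_comp x hG' hf)
  have hinner : (fun y ↦ (inner ℝ (s y) (t y) : ℝ)) =ᶠ[𝓝 x]
      fun y ↦ G (f y) (e ⟨f y, s y⟩).2 (e ⟨f y, t y⟩).2 := by
    filter_upwards [hf.continuousAt (e.open_baseSet.mem_nhds hb)] with y hy
    exact hGi _ hy _ _
  have hext : (fun p ↦ (inner ℝ (FiberBundle.extend E (s x) p : TangentSpace I p)
      (FiberBundle.extend E (t x) p : TangentSpace I p) : ℝ)) =ᶠ[𝓝 (f x)]
      fun p ↦ G p (e ⟨f x, s x⟩).2 (e ⟨f x, t x⟩).2 := by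
    filter_upwards [e.open_baseSet.mem_nhds hb] with p hp
    rw [hGi p hp, trivializationAt_extend I _ _ hp, trivializationAt_extend I _ _ hp]
  have hG1 : MDifferentiableAt J 𝓘(ℝ, E →L[ℝ] ℝ) (fun y ↦ G (f y) (e ⟨f y, s y⟩).2) x :=
    hGf.clm_apply hs'
  have hG2 : MDifferentiableAt I 𝓘(ℝ, E →L[ℝ] ℝ) (fun p ↦ G p (e ⟨f x, s x⟩).2) (f x) :=
    hG'.clm_apply mdifferentiableAt_const
  have h1 : mvfderiv J (fun y ↦ (inner ℝ (s y) (t y) : ℝ)) x w =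
      mvfderiv I G (f x) (mfderiv J I f x w) (e ⟨f x, s x⟩).2 (e ⟨f x, t x⟩).2 +
      G (f x) (mvfderiv J (fun y ↦ (e ⟨f y, s y⟩).2) x w) (e ⟨f x, t x⟩).2 +
      G (f x) (e ⟨f x, s x⟩).2 (mvfderiv J (fun y ↦ (e ⟨f y, t y⟩).2) x w) := by
    rw [← hGfd]
    refine (congrArg (fun L ↦ L w) (hinner.mfderiv_eq (I := J) (I' := 𝓘(ℝ, ℝ)))).trans ?_
    refine (mvfderiv_clm_apply hG1 ht' w).trans ?_
    rw [mvfderiv_clm_apply hGf hs' w]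
    rfl
  have h2 := mvfderiv_inner_extend hcov (f x) (s x) (t x) (mfderiv J I f x w)
  have h3 : mvfderiv I (fun p ↦ (inner ℝ (FiberBundle.extend E (s x) p : TangentSpace I p)
      (FiberBundle.extend E (t x) p : TangentSpace I p) : ℝ)) (f x) (mfderiv J I f x w) =
      mvfderiv I G (f x) (mfderiv J I f x w) (e ⟨f x, s x⟩).2 (e ⟨f x, t x⟩).2 := by
    refine (congrArg (fun L ↦ L (mfderiv J I f x w)) (hext.mfderiv_eq (I := I) (I' := 𝓘(ℝ, ℝ)))).trans ?_
    refine (mvfderiv_clm_apply hG2 mdifferentiableAt_const _).trans ?_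
    rw [mvfderiv_clm_apply hG' mdifferentiableAt_const, mvfderiv_const, mvfderiv_const]
    simp
  have hsymm : ∀ z : E, (e ⟨f x, e.symm (f x) z⟩).2 = z := fun z ↦
    congrArg Prod.snd (Trivialization.apply_mk_symm e hb z)
  rw [h1, ← h3, h2, pullbackConnection_apply, pullbackConnection_apply, inner_add_left,
    inner_add_right]
  have h4 : ∀ z : E, (inner ℝ (e.symmL ℝ (f x) z) (t x) : ℝ) = G (f x) z (e ⟨f x, t x⟩).2 := by
    intro z
    rw [hGi _ hb, Trivialization.symmL_apply, hsymm]
    exact hb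
  have h5 : ∀ z : E, (inner ℝ (s x) (e.symmL ℝ (f x) z) : ℝ) = G (f x) (e ⟨f x, s x⟩).2 z := by
    intro z
    rw [hGi _ hb, Trivialization.symmL_apply, hsymm]
    exact hb
  have h4' := h4 (mvfderiv J (fun y ↦ (e ⟨f y, s y⟩).2) x w)
  have h5' := h5 (mvfderiv J (fun y ↦ (e ⟨f y, t y⟩).2) x w)
  rw [← h4', ← h5']
  have h6 : ∀ a b c d : ℝ, a + b + c + d = (c + a) + (d + b) := fun _ _ _ _ ↦ by ring
  exact h6 _ _ _ _

end Metric

section Torsion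

variable {E : Type*} [NormedAddCommGroup E] [NormedSpace ℝ E]
  {H : Type*} [TopologicalSpace H] {I : ModelWithCorners ℝ E H}
  {M : Type*} [TopologicalSpace M] [ChartedSpace H M] [IsManifold I ∞ M]

theorem trivializationAt_self (p : M) (v : TangentSpace I p) :
    (trivializationAt E (TangentSpace I : M → Type _) p ⟨p, v⟩).2 = v :=
  (tangentBundleCore I M).coordChange_self (achart H p) p (mem_chart_source H p) v

theorem extend_eq_mfderivWithin {p q : M} (hq : q ∈ (chartAt H p).source)
    (a : TangentSpace I p) : FiberBundle.extend E a q =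
      mfderivWithin 𝓘(ℝ, E) I (extChartAt I p).symm (Set.range I) (extChartAt I p q) a := by
  have h : FiberBundle.extend E a q =
      (trivializationAt E (TangentSpace I : M → Type _) p).symmL ℝ q (a : E) := by
    have hq' : q ∈ (trivializationAt E (TangentSpace I : M → Type _) p).baseSet := hq
    exact (congrArg ((trivializationAt E (TangentSpace I : M → Type _) p).symm q)
      (trivializationAt_self p a)).trans (Trivialization.symmL_apply _ hq' _).symm
  exact h.trans (congrArg (fun L ↦ L a) (TangentBundle.symmL_trivializationAt (I := I) hq))

theorem mpullbackWithin_extend_eventuallyEq (p : M) (a : TangentSpace I p) :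
    VectorField.mpullbackWithin 𝓘(ℝ, E) I (extChartAt I p).symm (FiberBundle.extend E a)
      (Set.range I) =ᶠ[𝓝[Set.range I] extChartAt I p p] fun _ ↦ a := by
  filter_upwards [extChartAt_target_mem_nhdsWithin p] with y hy
  have hq : (extChartAt I p).symm y ∈ (chartAt H p).source := by
    rw [← extChartAt_source I]; exact (extChartAt I p).map_target hy
  rw [VectorField.mpullbackWithin_apply]
  have hinv := isInvertible_mfderivWithin_extChartAt_symm (I := I) hy
  have h2 := extend_eq_mfderivWithin hq a
  rw [(extChartAt I p).right_inv hy] at h2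
  rw [h2]
  exact hinv.inverse_apply_self a

theorem mlieBracket_extend (p : M) (a b : TangentSpace I p) :
    VectorField.mlieBracket I (FiberBundle.extend E a) (FiberBundle.extend E b) p = 0 := by
  rw [VectorField.mlieBracket, VectorField.mlieBracketWithin_apply, Set.preimage_univ, Set.univ_inter,
    Filter.EventuallyEq.lieBracketWithin_vectorField_eq_of_mem
      (mpullbackWithin_extend_eventuallyEq p a) (mpullbackWithin_extend_eventuallyEq p b) (Set.mem_range_self _)]
  have h : ∀ v w : E, VectorField.lieBracketWithin ℝ (fun _ : E ↦ v) (fun _ : E ↦ w)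
      (Set.range I) (extChartAt I p p) = 0 := fun v w ↦ by
    simp [VectorField.lieBracketWithin]
  exact (congrArg _ (h a b)).trans (map_zero _)

theorem cov_extend_symm [FiniteDimensional ℝ E]
  {cov : CovariantDerivative I E (fun x : M ↦ TangentSpace I x)}
  (h : cov.torsion = 0) (p : M) (a b : TangentSpace I p) :
  cov (FiberBundle.extend E b) p a = cov (FiberBundle.extend E a) p b := by
  have h1 := CovariantDerivative.torsion_apply_eq_extend cov a b
  rw [h, mlieBracket_extend] at h1
  simp only [FiberBundle.extend_apply_self] at h1
  have h2 : (0 : TangentSpace I p) = cov (FiberBundle.extend E b) p a - cov (FiberBundle.extend E a) p b - 0 := h1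
  rw [sub_zero] at h2
  exact sub_eq_zero.1 h2.symm

end Torsion

section Hessian

variable {E : Type*} [NormedAddCommGroup E] [NormedSpace ℝ E]
  {H : Type*} [TopologicalSpace H] {I : ModelWithCorners ℝ E H}
  {M : Type*} [TopologicalSpace M] [ChartedSpace H M] [IsManifold I ∞ M]
  {E' : Type*} [NormedAddCommGroup E'] [NormedSpace ℝ E']
  {H' : Type*} [TopologicalSpace H'] {J : ModelWithCorners ℝ E' H'}
  {N : Type*} [TopologicalSpace N] [ChartedSpace H' N] [IsManifold J ∞ N]

theorem trivializationAt_mfderiv_extend {f : N → M} (hf : ContMDiff J I ∞ f) (x : N)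
    (b : TangentSpace J x) :
    (fun y ↦ (trivializationAt E (TangentSpace I : M → Type _) (f x)
      ⟨f y, mfderiv J I f y (FiberBundle.extend E' b y)⟩).2) =ᶠ[𝓝 x] fun y ↦
        fderivWithin ℝ (writtenInExtChartAt J I x f) (Set.range J) (extChartAt J x y) b := by
  filter_upwards [extChartAt_source_mem_nhds (I := J) x,
    hf.continuous.continuousAt.preimage_mem_nhds (extChartAt_source_mem_nhds (I := I) (f x))] with y hy hfy
  have hy' := hy
  have hfy' : f y ∈ (extChartAt I (f x)).source := hfy
  rw [extChartAt_source] at hy' hfy'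
  have h2 := TangentBundle.continuousLinearMapAt_trivializationAt (I := I) hfy'
  have h3 := extend_eq_mfderivWithin hy' b
  have h4 : ∀ v : TangentSpace I (f y), (trivializationAt E (TangentSpace I : M → Type _) (f x)
      ⟨f y, v⟩).2 = mfderiv I 𝓘(ℝ, E) (extChartAt I (f x)) (f y) v := by
    intro v
    have hb : f y ∈ (trivializationAt E (TangentSpace I : M → Type _) (f x)).baseSet := hfy'
    have h5 : (trivializationAt E (TangentSpace I : M → Type _) (f x)).continuousLinearMapAt ℝ
        (f y) v = (trivializationAt E (TangentSpace I : M → Type _) (f x) ⟨f y, v⟩).2 := by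
      rw [Trivialization.continuousLinearMapAt_apply, Trivialization.coe_linearMapAt_of_mem _ hb]
    exact h5.symm.trans (congrArg (fun L ↦ L v) h2)
  rw [h4, h3]
  have hz : extChartAt J x y ∈ (extChartAt J x).target := (extChartAt J x).map_source hy
  have hyz : (extChartAt J x).symm (extChartAt J x y) = y := (extChartAt J x).left_inv hy
  have hu : UniqueMDiffWithinAt 𝓘(ℝ, E') (Set.range J) (extChartAt J x y) :=
    J.uniqueMDiffOn _ (extChartAt_target_subset_range x hz)
  have hs := mdifferentiableWithinAt_extChartAt_symm (I := J) hz
  have hfd : MDifferentiableAt J I f y := hf.mdifferentiableAt (by simp)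
  have hc := mdifferentiableAt_extChartAt (I := I) hfy'
  have e1 := mfderiv_comp_mfderivWithin_of_eq hfd hs hu hyz
  have hd1 : MDifferentiableWithinAt 𝓘(ℝ, E') I (f ∘ (extChartAt J x).symm) (Set.range J) (extChartAt J x y) :=
    MDifferentiableAt.comp_mdifferentiableWithinAt_of_eq _ hfd hs hyz
  have e2 := mfderiv_comp_mfderivWithin_of_eq hc hd1 hu (congrArg f hyz)
  have e3 : mfderivWithin 𝓘(ℝ, E') 𝓘(ℝ, E) (extChartAt I (f x) ∘ f ∘ (extChartAt J x).symm)
    (Set.range J) (extChartAt J x y) = fderivWithin ℝ (writtenInExtChartAt J I x f) (Set.range J)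
      (extChartAt J x y) := mfderivWithin_eq_fderivWithin
  have e4 := congrArg (fun L ↦ L b) (e3.symm.trans e2)
  have e5 := congrArg (fun L ↦ L b) e1
  refine Eq.trans ?_ e4.symm
  exact congrArg (mfderiv I 𝓘(ℝ, E) (extChartAt I (f x)) (f y)) e5.symm

/-- The Hessian of a map is symmetric. -/
theorem mvfderiv_mfderiv_extend_symm {f : N → M} (hf : ContMDiff J I ∞ f) (x : N)
    (a b : TangentSpace J x) :
    mvfderiv J (fun y ↦ (trivializationAt E (TangentSpace I : M → Type _) (f x)
      ⟨f y, mfderiv J I f y (FiberBundle.extend E' b y)⟩).2) x a =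
    mvfderiv J (fun y ↦ (trivializationAt E (TangentSpace I : M → Type _) (f x)
      ⟨f y, mfderiv J I f y (FiberBundle.extend E' a y)⟩).2) x b := by
  set F := writtenInExtChartAt J I x f with hF
  have hx : extChartAt J x x ∈ Set.range J := Set.mem_range_self _
  have hFs : ContDiffWithinAt ℝ ∞ F (Set.range J) (extChartAt J x x) :=
    (contMDiffAt_iff.1 (hf x)).2
  have hsymm : IsSymmSndFDerivWithinAt ℝ F (Set.range J) (extChartAt J x x) :=
    hFs.isSymmSndFDerivWithinAt
      (by rw [minSmoothness_of_isRCLikeNormedField]; exact ENat.LEInfty.out) J.uniqueDiffOn (J.range_subset_closure_interior hx) hx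
  have hD : ContDiffWithinAt ℝ ∞ (fderivWithin ℝ F (Set.range J)) (Set.range J)
      (extChartAt J x x) := hFs.fderivWithin_right J.uniqueDiffOn (by simp) hx
  have key : ∀ v w : E', mvfderiv J (fun y ↦ fderivWithin ℝ F (Set.range J) (extChartAt J x y) w) x v =
      fderivWithin ℝ (fderivWithin ℝ F (Set.range J)) (Set.range J) (extChartAt J x x) v w := by
    intro v w
    have hDd := hD.differentiableWithinAt (by simp)
    have hDw : DifferentiableWithinAt ℝ (fun z ↦ fderivWithin ℝ F (Set.range J) z w) (Set.range J)
      (extChartAt J x x) := hDd.clm_apply (differentiableWithinAt_const w)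
    have hm : MDifferentiableAt J 𝓘(ℝ, E)
        (fun y ↦ fderivWithin ℝ F (Set.range J) (extChartAt J x y) w) x :=
      mdifferentiableWithinAt_univ.1 (hDw.comp_mdifferentiableWithinAt
        (mdifferentiableAt_extChartAt (mem_chart_source H' x)).mdifferentiableWithinAt
        fun y _ ↦ Set.mem_range_self _)
    have hev : writtenInExtChartAt J 𝓘(ℝ, E) x
        (fun y ↦ fderivWithin ℝ F (Set.range J) (extChartAt J x y) w) =ᶠ[𝓝[Set.range J]
          extChartAt J x x] fun z ↦ fderivWithin ℝ F (Set.range J) z w := by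
      filter_upwards [extChartAt_target_mem_nhdsWithin x] with z hz
      exact congrArg (fun z ↦ fderivWithin ℝ F (Set.range J) z w)
        ((extChartAt J x).right_inv hz)
    rw [hm.mvfderiv, hev.fderivWithin_eq_of_mem hx,
      fderivWithin_clm_apply (J.uniqueDiffOn _ hx) hDd (differentiableWithinAt_const w),
      fderivWithin_fun_const, Pi.zero_apply, ContinuousLinearMap.comp_zero, zero_add]
    rfl
  refine ((congrArg (fun L ↦ L a) ((trivializationAt_mfderiv_extend hf x b).mfderiv_eq
    (I := J) (I' := 𝓘(ℝ, E)))).trans (key a b)).trans ((hsymm a b).trans ?_)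
  exact ((congrArg (fun L ↦ L b) ((trivializationAt_mfderiv_extend hf x a).mfderiv_eq
    (I := J) (I' := 𝓘(ℝ, E)))).trans (key b a)).symm

theorem mdifferentiableAt_mfderiv_extend (hf : ContMDiff J I ∞ f) (x : N) (b : TangentSpace J x) :
    MDifferentiableAt J I.tangent
      (fun y ↦ (⟨f y, mfderiv J I f y (FiberBundle.extend E' b y)⟩ : TangentBundle I M)) x := by
  have h1 : MDifferentiable J.tangent I.tangent (tangentMap J I f) :=
    (hf.contMDiff_tangentMap (m := 1)
      (by rw [one_add_one_eq_two]; exact ENat.LEInfty.out)).mdifferentiable one_ne_zero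
  exact (h1 _).comp x (FiberBundle.mdifferentiableAt_extend J E' b)

end Hessian

section HypersurfaceAlgebra

variable {V W : Type*} [NormedAddCommGroup V] [InnerProductSpace ℝ V]
  [NormedAddCommGroup W] [InnerProductSpace ℝ W] {L : V →ₗ[ℝ] W} {ν : W}

theorem orthonormal_cons_comp (hL : ∀ v w, (inner ℝ (L v) (L w) : ℝ) = inner ℝ v w)
    (hν : ‖ν‖ = 1) (hνL : ∀ v, (inner ℝ ν (L v) : ℝ) = 0) {n : ℕ} {b : Fin n → V}
    (hb : Orthonormal ℝ b) :
    Orthonormal ℝ (Fin.cons ν (fun j ↦ L (b j)) : Fin (n + 1) → W) := by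
  rw [orthonormal_iff_ite] at hb ⊢
  intro i j
  refine Fin.cases ?_ (fun i ↦ ?_) i <;> refine Fin.cases ?_ (fun j ↦ ?_) j
  · simp [hν]
  · simp [hνL, (Fin.succ_ne_zero j).symm]
  · simp [real_inner_comm, hνL]
  · simp [hL, hb]

variable [FiniteDimensional ℝ V] {n : ℕ}

theorem exists_orthonormalBasis_cons (hV : finrank ℝ V = n) (hW : finrank ℝ W = n + 1)
    (hL : ∀ v w, (inner ℝ (L v) (L w) : ℝ) = inner ℝ v w)
    (hν : ‖ν‖ = 1) (hνL : ∀ v, (inner ℝ ν (L v) : ℝ) = 0) :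
    ∃ (b : OrthonormalBasis (Fin n) ℝ V) (c : OrthonormalBasis (Fin (n + 1)) ℝ W),
      (c : Fin (n + 1) → W) = Fin.cons ν (fun j ↦ L (b j)) := by
  have : FiniteDimensional ℝ W := .of_finrank_pos (by lia)
  let b : OrthonormalBasis (Fin n) ℝ V := (stdOrthonormalBasis ℝ V).reindex (finCongr hV)
  have hc := orthonormal_cons_comp hL hν hνL b.orthonormal
  have hcard : Fintype.card (Fin (n + 1)) = finrank ℝ W := by rw [hW, Fintype.card_fin]
  have hspan := (basisOfOrthonormalOfCardEqFinrank hc hcard).span_eq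
  rw [coe_basisOfOrthonormalOfCardEqFinrank] at hspan
  exact ⟨b, OrthonormalBasis.mk hc hspan.ge, OrthonormalBasis.coe_mk _ _⟩

theorem eq_smul_of_forall_inner_eq_zero
    (hV : finrank ℝ V = n) (hW : finrank ℝ W = n + 1)
    (hL : ∀ v w, (inner ℝ (L v) (L w) : ℝ) = inner ℝ v w)
    (hν : ‖ν‖ = 1) (hνL : ∀ v, (inner ℝ ν (L v) : ℝ) = 0) {u : W}
    (hu : ∀ v, (inner ℝ u (L v) : ℝ) = 0) : u = (inner ℝ ν u : ℝ) • ν := by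
  obtain ⟨b, c, hc⟩ := exists_orthonormalBasis_cons hV hW hL hν hνL
  refine InnerProductSpace.ext_inner_left_basis c.toBasis fun i ↦ ?_
  rw [OrthonormalBasis.coe_toBasis, hc, inner_smul_right]
  refine Fin.cases ?_ (fun i ↦ ?_) i
  · simp [hν]
  · rw [Fin.cons_succ, real_inner_comm, hu, real_inner_comm ν (L (b i)), hνL, mul_zero]

theorem apply_adjoint_of_inner_eq_zero [FiniteDimensional ℝ W]
    (hV : finrank ℝ V = n) (hW : finrank ℝ W = n + 1)
    (hL : ∀ v w, (inner ℝ (L v) (L w) : ℝ) = inner ℝ v w)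
    (hν : ‖ν‖ = 1) (hνL : ∀ v, (inner ℝ ν (L v) : ℝ) = 0) {u : W}
    (hu : (inner ℝ ν u : ℝ) = 0) : L (L.adjoint u) = u := by
  have h := eq_smul_of_forall_inner_eq_zero hV hW hL hν hνL (u := u - L (L.adjoint u))
    fun v ↦ by rw [inner_sub_left, hL, LinearMap.adjoint_inner_left, sub_self]
  rw [inner_sub_right, hu, hνL, sub_zero, zero_smul, sub_eq_zero] at h
  exact h.symm

theorem volumeForm_cons_comp [hV : Fact (finrank ℝ V = n)]
    [hW : Fact (finrank ℝ W = n + 1)] (hL : ∀ v w, (inner ℝ (L v) (L w) : ℝ) = inner ℝ v w)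
    (hν : ‖ν‖ = 1) (hνL : ∀ v, (inner ℝ ν (L v) : ℝ) = 0)
    (oV : Orientation ℝ V (Fin n)) (oW : Orientation ℝ W (Fin (n + 1)))
    (h : ∀ v : Fin n → V,
      0 < oW.volumeForm (Fin.cons ν (fun j ↦ L (v j))) ↔ 0 < oV.volumeForm v)
    (v : Fin n → V) :
    oW.volumeForm (Fin.cons ν (fun j ↦ L (v j))) = oV.volumeForm v := by
  obtain ⟨b, c, hc⟩ := exists_orthonormalBasis_cons hV.out hW.out hL hν hνL
  have h1 := oV.abs_volumeForm_apply_of_orthonormal b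
  have h2 := oW.abs_volumeForm_apply_of_orthonormal c
  have h3 := h b
  rw [hc] at h2
  have h4 : oW.volumeForm (Fin.cons ν (fun j ↦ L (b j))) = oV.volumeForm b := by
    rcases eq_or_eq_neg_of_abs_eq h1 with h1 | h1 <;>
      rcases eq_or_eq_neg_of_abs_eq h2 with h2 | h2 <;> rw [h1, h2] at h3 ⊢ <;> norm_num at h3
  have h5 : (oW.volumeForm.curryLeft ν).compLinearMap L - oV.volumeForm = 0 := by
    rw [← AlternatingMap.map_basis_eq_zero_iff b.toBasis, AlternatingMap.sub_apply, sub_eq_zero,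
      OrthonormalBasis.coe_toBasis]
    exact h4
  exact congrArg (fun η ↦ η v) (sub_eq_zero.1 h5)

end HypersurfaceAlgebra

section OrientationSign

variable {V F : Type*} [NormedAddCommGroup V] [InnerProductSpace ℝ V] {m : ℕ}
  [hV : Fact (finrank ℝ V = m)] [FiniteDimensional ℝ V] [AddCommGroup F] [Module ℝ F]

theorem exists_volumeForm_rayOfNeZero (o : Orientation ℝ V (Fin m)) :
    ∃ h : o.volumeForm ≠ 0, rayOfNeZero ℝ o.volumeForm h = o := by
  let b : OrthonormalBasis (Fin m) ℝ V := (stdOrthonormalBasis ℝ V).reindex (finCongr hV.out)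
  by_cases hb : b.toBasis.orientation = o
  · rw [o.volumeForm_robust b hb]
    exact ⟨b.toBasis.det_ne_zero, hb⟩
  · rw [o.volumeForm_robust_neg b hb]
    refine ⟨neg_ne_zero.2 b.toBasis.det_ne_zero, ?_⟩
    rw [← neg_rayOfNeZero ℝ _ b.toBasis.det_ne_zero]
    change -b.toBasis.orientation = o
    exact ((b.toBasis.orientation_ne_iff_eq_neg o).1 (Ne.symm hb)).symm

theorem exists_pos_volumeForm_eq (o : Orientation ℝ V (Fin m)) (φ : V ≃ₗ[ℝ] F) :
    ∃ r : ℝ, 0 < r ∧ ∀ v : Fin m → V,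
      o.volumeForm v = r * (Orientation.map (Fin m) φ o).someVector (fun j ↦ φ (v j)) := by
  obtain ⟨h, ho⟩ := exists_volumeForm_rayOfNeZero o
  have h1 := (Orientation.map (Fin m) φ o).someVector_ray
  conv_rhs at h1 => rw [← ho, Orientation.map_apply]
  obtain ⟨r, hr, h2⟩ := ((ray_eq_iff _ _).1 h1.symm).exists_pos_left
    (mt (o.volumeForm.compLinearEquiv_eq_zero_iff φ.symm).mp h)
    (Orientation.map (Fin m) φ o).someVector_ne_zero
  refine ⟨r⁻¹, inv_pos.2 hr, fun v ↦ ?_⟩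
  rw [← h2]
  simp [hr.ne']

theorem continuous_alternatingMap_apply {F : Type*} [NormedAddCommGroup F] [NormedSpace ℝ F]
    [FiniteDimensional ℝ F] (hF : finrank ℝ F = m) (η : F [⋀^Fin m]→ₗ[ℝ] ℝ) :
    Continuous fun v : Fin m → F ↦ η v := by
  let b : Basis (Fin m) ℝ F := (finBasis ℝ F).reindex (finCongr hF)
  rw [η.eq_smul_basis_det b]
  simp only [AlternatingMap.smul_apply, Basis.det_apply]
  have h : Continuous fun v : Fin m → F ↦ b.toMatrix v := continuous_matrix fun i j ↦
    (LinearMap.continuous_of_finiteDimensional (b.coord i)).comp (continuous_apply j)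
  exact continuous_const.mul h.matrix_det

end OrientationSign

section OperatorValuedMaps

variable {E' : Type*} [NormedAddCommGroup E'] [NormedSpace ℝ E']
  {H' : Type*} [TopologicalSpace H'] {J : ModelWithCorners ℝ E' H'}
  {P : Type*} [TopologicalSpace P] [ChartedSpace H' P]
  {F₁ F₂ F₃ : Type*} [NormedAddCommGroup F₁] [NormedSpace ℝ F₁]
  [NormedAddCommGroup F₂] [NormedSpace ℝ F₂] [NormedAddCommGroup F₃] [NormedSpace ℝ F₃] {x₀ : P}

set_option synthInstance.maxHeartbeats 200000 in
theorem contMDiffAt_clm_flip {B : P → F₁ →L[ℝ] F₂ →L[ℝ] F₃}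
    (hB : ContMDiffAt J 𝓘(ℝ, F₁ →L[ℝ] F₂ →L[ℝ] F₃) ∞ B x₀) :
    ContMDiffAt J 𝓘(ℝ, F₂ →L[ℝ] F₁ →L[ℝ] F₃) ∞ (fun y ↦ (B y).flip) x₀ := by
  have h : ContDiff ℝ ∞ (fun B : F₁ →L[ℝ] F₂ →L[ℝ] F₃ ↦ B.flip) :=
    LinearIsometryEquiv.contDiff (𝕜 := ℝ) (E := F₁ →L[ℝ] F₂ →L[ℝ] F₃)
      (F := F₂ →L[ℝ] F₁ →L[ℝ] F₃) (ContinuousLinearMap.flipₗᵢ ℝ F₁ F₂ F₃)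
  exact h.contDiffAt.comp_contMDiffAt hB

theorem contMDiffAt_clm_prod {A : P → F₁ →L[ℝ] F₂} {B : P → F₁ →L[ℝ] F₃}
    (hA : ContMDiffAt J 𝓘(ℝ, F₁ →L[ℝ] F₂) ∞ A x₀) (hB : ContMDiffAt J 𝓘(ℝ, F₁ →L[ℝ] F₃) ∞ B x₀) :
    ContMDiffAt J 𝓘(ℝ, F₁ →L[ℝ] F₂ × F₃) ∞ (fun y ↦ (A y).prod (B y)) x₀ := by
  have h : ContDiff ℝ ∞
      (fun q : (F₁ →L[ℝ] F₂) × (F₁ →L[ℝ] F₃) ↦ q.1.prod q.2) :=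
    (ContinuousLinearMap.prodₗᵢ (𝕜 := ℝ) (E := F₁) (F := F₂) (G := F₃) ℝ).contDiff
  exact h.contDiffAt.comp_contMDiffAt (hA.prodMk_space hB)

end OperatorValuedMaps

section SmoothNormal

variable {E : Type*} [NormedAddCommGroup E] [NormedSpace ℝ E] [FiniteDimensional ℝ E]
  {E' : Type*} [NormedAddCommGroup E'] [NormedSpace ℝ E'] [FiniteDimensional ℝ E']

theorem injective_clm_prod_of_orthogonal {D : E' →L[ℝ] E} {G : E →L[ℝ] E →L[ℝ] ℝ} {z₀ : E}
    (hdim : finrank ℝ E = finrank ℝ E' + 1) (hG : ∀ z, z ≠ 0 → 0 < G z z)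
    (hD : Function.Injective D) (h1 : G z₀ z₀ = 1) (h2 : ∀ v, G z₀ (D v) = 0) {z : E}
    (hz : ∀ v, G z (D v) = 0) (hz₀ : G z z₀ = 0) : z = 0 := by
  let S : (E' × ℝ) →ₗ[ℝ] E := D.toLinearMap.coprod (LinearMap.toSpanSingleton ℝ E z₀)
  have hS : Function.Injective S := by
    rw [injective_iff_map_eq_zero]
    rintro ⟨v, t⟩ h
    have h3 : D v + t • z₀ = 0 := h
    have ht : t = 0 := by
      have h4 := congrArg (G z₀) h3
      simpa [h1, h2] using h4
    rw [ht, zero_smul, add_zero] at h3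
    rw [ht, hD (h3.trans (map_zero D).symm)]
    rfl
  have hS' : Function.Surjective S := by
    refine (LinearMap.injective_iff_surjective_of_finrank_eq_finrank ?_).1 hS
    rw [hdim, finrank_prod, finrank_self]
  obtain ⟨⟨v, t⟩, h⟩ := hS' z
  by_contra hne
  have h3 : D v + t • z₀ = z := h
  have h4 := hG z hne
  nth_rw 2 [← h3] at h4
  simp [hz, hz₀] at h4

variable {H' : Type*} [TopologicalSpace H'] {J : ModelWithCorners ℝ E' H'}
  {P : Type*} [TopologicalSpace P] [ChartedSpace H' P]

theorem contMDiffAt_of_orthonormal_of_pos {m : ℕ} (hm : finrank ℝ E = m + 1)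
    (hm' : finrank ℝ E' = m) {D : P → E' →L[ℝ] E}
    {G : P → E →L[ℝ] E →L[ℝ] ℝ} {z : P → E} {x₀ : P}
    (hD : ContMDiffAt J 𝓘(ℝ, E' →L[ℝ] E) ∞ D x₀)
    (hG : ContMDiffAt J 𝓘(ℝ, E →L[ℝ] E →L[ℝ] ℝ) ∞ G x₀)
    (hpos : ∀ v, v ≠ 0 → 0 < G x₀ v v) (hinj : Function.Injective (D x₀))
    (h1 : ∀ᶠ y in 𝓝 x₀, G y (z y) (z y) = 1)
    (h2 : ∀ᶠ y in 𝓝 x₀, ∀ v, G y (z y) (D y v) = 0)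
    (η : E [⋀^Fin (m + 1)]→ₗ[ℝ] ℝ) (b : Fin m → E')
    (h3 : ∀ᶠ y in 𝓝 x₀, 0 < η (Fin.cons (z y) (fun j ↦ D y (b j)))) :
    ContMDiffAt J 𝓘(ℝ, E) ∞ z x₀ := by
  have : CompleteSpace E := FiniteDimensional.complete ℝ E
  let T : P → E →L[ℝ] (E' →L[ℝ] ℝ) × ℝ := fun y ↦
    ((G y).flip ∘L D y).flip.prod ((G y).flip (z x₀))
  have hT : ContMDiffAt J 𝓘(ℝ, E →L[ℝ] (E' →L[ℝ] ℝ) × ℝ) ∞ T x₀ := by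
    have e1 := contMDiffAt_clm_flip hG
    have e2 := contMDiffAt_clm_flip (e1.clm_comp hD)
    exact contMDiffAt_clm_prod e2 (e1.clm_apply contMDiffAt_const)
  have hTinj : Function.Injective (T x₀) := by
    rw [injective_iff_map_eq_zero]
    intro v hv
    have hv1 := congrArg Prod.fst hv
    have hv2 := congrArg Prod.snd hv
    exact injective_clm_prod_of_orthogonal (by rw [hm, hm']) hpos hinj h1.self_of_nhds
      h2.self_of_nhds (fun w ↦ congrArg (fun L ↦ L w) hv1) hv2
  have hdim : finrank ℝ E = finrank ℝ ((E' →L[ℝ] ℝ) × ℝ) := by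
    rw [finrank_prod, finrank_self, hm, ← hm']
    congr 1
    rw [← (LinearMap.toContinuousLinearMap (𝕜 := ℝ) (E := E') (F' := ℝ)).finrank_eq]
    exact (Subspace.dual_finrank_eq (K := ℝ) (V := E')).symm
  let Te : E ≃L[ℝ] (E' →L[ℝ] ℝ) × ℝ :=
    (LinearEquiv.ofInjectiveOfFinrankEq (T x₀).toLinearMap hTinj hdim).toContinuousLinearEquiv
  have hTe : (Te : E →L[ℝ] (E' →L[ℝ] ℝ) × ℝ) = T x₀ := rfl
  let ζ : P → E := fun y ↦ (T y).inverse (0, 1)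
  have hζ : ContMDiffAt J 𝓘(ℝ, E) ∞ ζ x₀ := by
    have h := (contDiffAt_map_inverse (𝕜 := ℝ) (n := ∞) Te)
    rw [hTe] at h
    exact (h.comp_contMDiffAt hT).clm_apply contMDiffAt_const
  have hTζ : ∀ᶠ y in 𝓝 x₀, (T y).IsInvertible := by
    filter_upwards [hT.continuousAt.preimage_mem_nhds (hTe ▸ Te.nhds)] with y hy using hy
  have hc : ∀ᶠ y in 𝓝 x₀, z y = G y (z y) (z x₀) • ζ y := by
    filter_upwards [hTζ, h2] with y hy hy2
    obtain ⟨e, he⟩ := hy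
    have h4 : ζ y = e.symm (0, 1) := by
      simp only [ζ, ← he, ContinuousLinearMap.inverse_equiv]; rfl
    rw [h4, ← map_smul, ContinuousLinearEquiv.eq_symm_apply]
    have h5 : e (z y) = T y (z y) := by rw [← he]; rfl
    rw [h5]
    refine Prod.ext ?_ ?_
    · ext v
      simpa [T] using hy2 v
    · simp [T]
  have hζ₀ : ζ x₀ = z x₀ := by
    have h4 := hc.self_of_nhds
    rw [h1.self_of_nhds, one_smul] at h4
    exact h4.symm
  have hηζ : ∀ᶠ y in 𝓝 x₀, 0 < η (Fin.cons (ζ y) (fun j ↦ D y (b j))) := by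
    have hcont : ContinuousAt (fun y ↦ η (Fin.cons (ζ y) (fun j ↦ D y (b j)))) x₀ := by
      refine (continuous_alternatingMap_apply hm η).continuousAt.comp (continuousAt_pi.2 fun i ↦ ?_)
      refine Fin.cases ?_ (fun j ↦ ?_) i
      · exact hζ.continuousAt
      · exact hD.continuousAt.clm_apply continuousAt_const
    refine hcont.eventually (lt_mem_nhds ?_)
    simp only [hζ₀]
    exact h3.self_of_nhds
  have hz : z =ᶠ[𝓝 x₀] fun y ↦ (√(G y (ζ y) (ζ y)))⁻¹ • ζ y := by
    filter_upwards [hc, hηζ, h1, h3] with y hy hy2 hy1 hy3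
    set c := G y (z y) (z x₀) with hcdef
    have hc0 : 0 < c := by
      rw [hy] at hy3
      have h6 : η (Fin.cons (c • ζ y) (fun j ↦ D y (b j))) =
          c * η (Fin.cons (ζ y) (fun j ↦ D y (b j))) :=
        congrArg (fun L ↦ L (fun j ↦ D y (b j))) (η.curryLeft.map_smul c (ζ y))
      rw [h6] at hy3
      exact pos_of_mul_pos_left hy3 hy2.le
    have h7 : c * c * G y (ζ y) (ζ y) = 1 := by
      rw [← hy1, hy]
      simp [mul_assoc]
    have h8 : G y (ζ y) (ζ y) = c⁻¹ ^ 2 := by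
      field_simp
      linarith
    rw [h8, Real.sqrt_sq (inv_pos.2 hc0).le, inv_inv]
    exact hy
  refine ContMDiffAt.congr_of_eventuallyEq ?_ hz
  have hGζ : ContMDiffAt J 𝓘(ℝ, ℝ) ∞ (fun y ↦ G y (ζ y) (ζ y)) x₀ :=
    (hG.clm_apply hζ).clm_apply hζ
  have hne : G x₀ (ζ x₀) (ζ x₀) ≠ 0 := by rw [hζ₀, h1.self_of_nhds]; exact one_ne_zero
  have hsq : ContDiffAt ℝ ∞ (fun t : ℝ ↦ (√t)⁻¹) (G x₀ (ζ x₀) (ζ x₀)) :=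
    (Real.contDiffAt_sqrt hne).inv (by rw [hζ₀, h1.self_of_nhds]; simp)
  have hs : ContMDiffAt J 𝓘(ℝ, ℝ) ∞ (fun y ↦ (√(G y (ζ y) (ζ y)))⁻¹) x₀ :=
    ContDiffAt.comp_contMDiffAt (g := fun t : ℝ ↦ (√t)⁻¹) hsq hGζ
  exact ContMDiffAt.smul hs hζ

end SmoothNormal

section Immersion

variable {E : Type*} [NormedAddCommGroup E] [NormedSpace ℝ E]
  {H : Type*} [TopologicalSpace H] {I : ModelWithCorners ℝ E H}
  {M : Type*} [TopologicalSpace M] [ChartedSpace H M]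
  [RiemannianBundle (fun x : M ↦ TangentSpace I x)]
  {E' : Type*} [NormedAddCommGroup E'] [NormedSpace ℝ E']
  {H' : Type*} [TopologicalSpace H'] {J : ModelWithCorners ℝ E' H'}
  {N : Type*} [TopologicalSpace N] [ChartedSpace H' N]
  [RiemannianBundle (fun x : N ↦ TangentSpace J x)] {f : N → M}

theorem IsIsometricImmersion.injective_mfderiv (hf : IsIsometricImmersion I J f) (x : N) :
    Function.Injective (mfderiv J I f x) := by
  rw [injective_iff_map_eq_zero]
  intro v hv
  have h := hf.inner_eq x v v
  rw [hv, inner_zero_left] at h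
  exact inner_self_eq_zero.1 h.symm

end Immersion

section UnitNormal

variable {E : Type*} [NormedAddCommGroup E] [NormedSpace ℝ E]
  {H : Type*} [TopologicalSpace H] {I : ModelWithCorners ℝ E H}
  {M : Type*} [TopologicalSpace M] [ChartedSpace H M] [IsManifold I ∞ M]
  [RiemannianBundle (fun x : M ↦ TangentSpace I x)]
  {E' : Type*} [NormedAddCommGroup E'] [NormedSpace ℝ E'] [FiniteDimensional ℝ E']
  {H' : Type*} [TopologicalSpace H'] {J : ModelWithCorners ℝ E' H'}
  {N : Type*} [TopologicalSpace N] [ChartedSpace H' N] [IsManifold J ∞ N]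
  [RiemannianBundle (fun x : N ↦ TangentSpace J x)]
  {n : ℕ} [Fact (finrank ℝ E = n + 1)] [Fact (finrank ℝ E' = n)]
  {oM : ManifoldOrientation I M (n + 1)} {oN : ManifoldOrientation J N n}
  {f : N → M} {ν : ∀ x : N, TangentSpace I (f x)}

theorem volumeForm_cons_unitNormal (hf : IsIsometricImmersion I J f)
    (hν : IsOrientedUnitNormal oM oN f ν) (x : N) (v : Fin n → TangentSpace J x) :
    (oM.orient (f x)).volumeForm (Fin.cons (ν x) (fun j ↦ mfderiv J I f x (v j))) =
      (oN.orient x).volumeForm v :=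
  volumeForm_cons_comp (L := (mfderiv J I f x).toLinearMap) (hf.inner_eq x) (hν.norm_eq_one x)
    (hν.normal x) (oN.orient x) (oM.orient (f x)) (hν.direct x) v

variable [FiniteDimensional ℝ E]

theorem exists_alternatingMap_unitNormal_pos (hf : IsIsometricImmersion I J f)
    (hν : IsOrientedUnitNormal oM oN f ν) (x₀ : N) (b : Basis (Fin n) ℝ E') :
    ∃ η : E [⋀^Fin (n + 1)]→ₗ[ℝ] ℝ, ∀ᶠ y in 𝓝 x₀, 0 < η (Fin.cons
      (trivializationAt E (TangentSpace I : M → Type _) (f x₀) ⟨f y, ν y⟩).2 (fun j ↦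
        (trivializationAt E (TangentSpace I : M → Type _) (f x₀) ⟨f y, mfderiv J I f y
          ((trivializationAt E' (TangentSpace J : N → Type _) x₀).symm y (b j))⟩).2)) := by
  set e := trivializationAt E (TangentSpace I : M → Type _) (f x₀) with he
  set e' := trivializationAt E' (TangentSpace J : N → Type _) x₀ with he'
  obtain ⟨o, ho⟩ := oM.locallyConstant (f x₀)
  obtain ⟨o', ho'⟩ := oN.locallyConstant x₀
  have hK : o'.someVector b ≠ 0 :=
    (AlternatingMap.map_basis_ne_zero_iff b _).2 o'.someVector_ne_zero
  refine ⟨o'.someVector b • o.someVector, ?_⟩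
  have hb : f x₀ ∈ e.baseSet := FiberBundle.mem_baseSet_trivializationAt' (f x₀)
  have hb' : x₀ ∈ e'.baseSet := FiberBundle.mem_baseSet_trivializationAt' x₀
  have hfc := hf.contMDiff.continuous.continuousAt (x := x₀)
  filter_upwards [hfc.eventually ho, hfc (e.open_baseSet.mem_nhds hb), ho',
    e'.open_baseSet.mem_nhds hb'] with y h1 h2 h3 h4
  obtain ⟨r, hr, h5⟩ := exists_pos_volumeForm_eq (oM.orient (f y)) (e.linearEquivAt ℝ (f y) h2)
  obtain ⟨r', hr', h6⟩ := exists_pos_volumeForm_eq (oN.orient y) (e'.linearEquivAt ℝ y h4)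
  rw [h1 h2] at h5
  rw [h3 h4] at h6
  have h7 := volumeForm_cons_unitNormal hf hν y (fun j ↦ e'.symm y (b j))
  rw [h5, h6] at h7
  have h8 : (fun j ↦ e'.linearEquivAt ℝ y h4 (e'.symm y (b j))) = b := by
    ext j
    exact congrArg Prod.snd (Trivialization.apply_mk_symm e' h4 (b j))
  rw [h8] at h7
  have h9 : (fun j ↦ e.linearEquivAt ℝ (f y) h2 (Fin.cons (α := fun _ ↦ TangentSpace I (f y)) (ν y)
      (fun j ↦ mfderiv J I f y (e'.symm y (b j))) j)) = Fin.cons (e ⟨f y, ν y⟩).2 (fun j ↦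
        (e ⟨f y, mfderiv J I f y (e'.symm y (b j))⟩).2) := by
    ext j
    refine Fin.cases rfl (fun j ↦ rfl) j
  rw [h9] at h7
  refine pos_of_mul_pos_right (a := r) ?_ hr.le
  rw [AlternatingMap.smul_apply, smul_eq_mul, mul_left_comm, h7, mul_left_comm]
  exact mul_pos hr' (mul_self_pos.2 hK)

variable [IsContMDiffRiemannianBundle I ∞ E (fun x : M ↦ TangentSpace I x)]

theorem contMDiff_unitNormal (hf : IsIsometricImmersion I J f)
    (hν : IsOrientedUnitNormal oM oN f ν) :
    ContMDiff J I.tangent ∞ (fun y ↦ (⟨f y, ν y⟩ : TangentBundle I M)) := by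
  intro x₀
  set e := trivializationAt E (TangentSpace I : M → Type _) (f x₀) with he
  set e' := trivializationAt E' (TangentSpace J : N → Type _) x₀ with he'
  have hb : f x₀ ∈ e.baseSet := FiberBundle.mem_baseSet_trivializationAt' (f x₀)
  have hb' : x₀ ∈ e'.baseSet := FiberBundle.mem_baseSet_trivializationAt' x₀
  obtain ⟨G, hG, hGi⟩ := exists_metric_in_trivialization I (f x₀)
  have hfc := hf.contMDiff.continuous.continuousAt (x := x₀)
  refine contMDiffAt_totalSpace.2 ⟨hf.contMDiff x₀, ?_⟩
  change ContMDiffAt J 𝓘(ℝ, E) ∞ (fun y ↦ (e ⟨f y, ν y⟩).2) x₀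
  let b : Basis (Fin n) ℝ E' := (finBasis ℝ E').reindex (finCongr Fact.out)
  obtain ⟨η, hη⟩ := exists_alternatingMap_unitNormal_pos hf hν x₀ b
  have hD : ContMDiffAt J 𝓘(ℝ, E' →L[ℝ] E) ∞
      (inTangentCoordinates J I id f (fun y ↦ mfderiv J I f y) x₀) x₀ :=
    (hf.contMDiff x₀).mfderiv_const (by simp)
  have hDv : ∀ y ∈ e'.baseSet, f y ∈ e.baseSet → ∀ v : E',
      inTangentCoordinates J I id f (fun y ↦ mfderiv J I f y) x₀ y v =
        (e ⟨f y, mfderiv J I f y (e'.symm y v)⟩).2 := by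
    intro y hy hfy v
    have h : inTangentCoordinates J I id f (fun y ↦ mfderiv J I f y) x₀ y v =
      e.continuousLinearMapAt ℝ (f y) (mfderiv J I f y (e'.symmL ℝ y v)) := rfl
    rw [h, Trivialization.continuousLinearMapAt_apply, Trivialization.coe_linearMapAt_of_mem _ hfy,
      Trivialization.symmL_apply _ hy]
  have hnear : ∀ᶠ y in 𝓝 x₀, y ∈ e'.baseSet ∧ f y ∈ e.baseSet :=
    Filter.Eventually.and (e'.open_baseSet.mem_nhds hb') (hfc (e.open_baseSet.mem_nhds hb))
  refine contMDiffAt_of_orthonormal_of_pos (m := n) Fact.out Fact.out hD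
    (G := fun y ↦ G (f y)) (hG.comp x₀ (hf.contMDiff x₀)) ?_ ?_ ?_ ?_ η b ?_
  · intro v hv
    have h1 : ∀ w : TangentSpace I (f x₀), w ≠ 0 → (0 : ℝ) < inner ℝ w w := fun w hw ↦
      real_inner_self_pos.2 hw
    exact (h1 v hv).trans_eq ((hGi (f x₀) hb v v).trans
      (congrArg (fun z : E ↦ G (f x₀) z z) (trivializationAt_self (f x₀) v)))
  · rw [injective_iff_map_eq_zero]
    intro v hv
    rw [hDv x₀ hb' hb] at hv
    have h1 := hf.injective_mfderiv x₀
      (((trivializationAt_self (f x₀) _).symm.trans hv).trans (map_zero (mfderiv J I f x₀)).symm)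
    have h2 : (e' ⟨x₀, e'.symm x₀ v⟩).2 = v :=
      congrArg Prod.snd (Trivialization.apply_mk_symm e' hb' v)
    exact (h2.symm.trans (trivializationAt_self x₀ _)).trans h1
  · filter_upwards [hnear] with y hy
    rw [← hGi (f y) hy.2, real_inner_self_eq_norm_sq, hν.norm_eq_one, one_pow]
  · filter_upwards [hnear] with y hy v
    rw [hDv y hy.1 hy.2, ← hGi (f y) hy.2, hν.normal]
  · filter_upwards [hnear, hη] with y hy h
    simp only [hDv y hy.1 hy.2]
    exact h

end UnitNormal

section SecondFundamentalForm

variable {E : Type*} [NormedAddCommGroup E] [NormedSpace ℝ E] [FiniteDimensional ℝ E]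
  {H : Type*} [TopologicalSpace H] {I : ModelWithCorners ℝ E H}
  {M : Type*} [TopologicalSpace M] [ChartedSpace H M] [IsManifold I ∞ M]
  {E' : Type*} [NormedAddCommGroup E'] [NormedSpace ℝ E']
  {H' : Type*} [TopologicalSpace H'] {J : ModelWithCorners ℝ E' H'}
  {N : Type*} [TopologicalSpace N] [ChartedSpace H' N] [IsManifold J ∞ N]
  {cov : CovariantDerivative I E (fun x : M ↦ TangentSpace I x)}
  {f : N → M} {ν : ∀ x : N, TangentSpace I (f x)}

theorem pullbackConnection_mfderiv_extend_symm (hcov : cov.torsion = 0) (hf : ContMDiff J I ∞ f)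
    (x : N) (a b : TangentSpace J x) :
    pullbackConnection J cov f (fun y ↦ mfderiv J I f y (FiberBundle.extend E' b y)) x a =
      pullbackConnection J cov f (fun y ↦ mfderiv J I f y (FiberBundle.extend E' a y)) x b := by
  rw [pullbackConnection_apply, pullbackConnection_apply]
  refine congrArg₂ _ (congrArg _ (mvfderiv_mfderiv_extend_symm hf x a b)) ?_
  simp only [FiberBundle.extend_apply_self]
  exact cov_extend_symm hcov (f x) _ _

variable [FiniteDimensional ℝ E']

variable [RiemannianBundle (fun x : M ↦ TangentSpace I x)]
  [IsContMDiffRiemannianBundle I ∞ E (fun x : M ↦ TangentSpace I x)]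
  [RiemannianBundle (fun x : N ↦ TangentSpace J x)]
  {n : ℕ} [Fact (finrank ℝ E = n + 1)] [Fact (finrank ℝ E' = n)]
  {oM : ManifoldOrientation I M (n + 1)} {oN : ManifoldOrientation J N n}

theorem inner_pullbackConnection_unitNormal_self (hcov : IsLeviCivita cov)
    (hf : IsIsometricImmersion I J f) (hν : IsOrientedUnitNormal oM oN f ν) (x : N)
    (w : TangentSpace J x) : (inner ℝ (ν x) (pullbackConnection J cov f ν x w) : ℝ) = 0 := by
  have hs : MDifferentiableAt J I.tangent (fun y ↦ (⟨f y, ν y⟩ : TangentBundle I M)) x :=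
    (contMDiff_unitNormal hf hν).mdifferentiableAt (by simp)
  have h := mvfderiv_inner_eq_pullbackConnection hcov.metric hs hs w
  have h1 : (fun y ↦ (inner ℝ (ν y) (ν y) : ℝ)) = fun _ ↦ 1 := by
    ext y
    rw [real_inner_self_eq_norm_sq, hν.norm_eq_one, one_pow]
  rw [h1, mvfderiv_const, real_inner_comm] at h
  have h2 : (0 : ℝ) = _ := h
  linarith

theorem inner_secondFundamentalForm (hcov : IsLeviCivita cov)
    (hf : IsIsometricImmersion I J f) (hν : IsOrientedUnitNormal oM oN f ν) (x : N)
    (a b : TangentSpace J x) :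
    (inner ℝ (secondFundamentalForm J cov f ν x a) b : ℝ) = inner ℝ (ν x)
      (pullbackConnection J cov f (fun y ↦ mfderiv J I f y (FiberBundle.extend E' b y)) x a) := by
  have hs : MDifferentiableAt J I.tangent (fun y ↦ (⟨f y, ν y⟩ : TangentBundle I M)) x :=
    (contMDiff_unitNormal hf hν).mdifferentiableAt (by simp)
  have h := mvfderiv_inner_eq_pullbackConnection hcov.metric hs
    (mdifferentiableAt_mfderiv_extend hf.contMDiff x b) a
  simp only [hν.normal, mvfderiv_const, FiberBundle.extend_apply_self] at h
  have h2 : (0 : ℝ) = _ := h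
  have h3 : (inner ℝ (secondFundamentalForm J cov f ν x a) b : ℝ) =
      -inner ℝ (pullbackConnection J cov f ν x a) (mfderiv J I f x b) := by
    rw [secondFundamentalForm, LinearMap.neg_apply, inner_neg_left, LinearMap.comp_apply,
      LinearMap.adjoint_inner_left]
    rfl
  rw [h3]
  linarith

theorem isSymmetric_secondFundamentalForm (hcov : IsLeviCivita cov)
    (hf : IsIsometricImmersion I J f) (hν : IsOrientedUnitNormal oM oN f ν) (x : N) :
    (secondFundamentalForm J cov f ν x).IsSymmetric := by
  intro a b
  rw [inner_secondFundamentalForm hcov hf hν, real_inner_comm _ a,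
    inner_secondFundamentalForm hcov hf hν,
    pullbackConnection_mfderiv_extend_symm hcov.torsion_eq_zero hf.contMDiff]

/-- The Weingarten equation. -/
theorem mfderiv_neg_secondFundamentalForm (hcov : IsLeviCivita cov)
    (hf : IsIsometricImmersion I J f) (hν : IsOrientedUnitNormal oM oN f ν) (x : N)
    (w : TangentSpace J x) :
    mfderiv J I f x ((-secondFundamentalForm J cov f ν x) w) =
      pullbackConnection J cov f ν x w := by
  rw [secondFundamentalForm, neg_neg]
  exact apply_adjoint_of_inner_eq_zero (n := n) (L := (mfderiv J I f x).toLinearMap) Fact.out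
    Fact.out (hf.inner_eq x) (hν.norm_eq_one x) (hν.normal x)
    (inner_pullbackConnection_unitNormal_self hcov hf hν x w)

theorem alphaForm_mfderiv_lift (hcov : IsLeviCivita cov)
    (hf : IsIsometricImmersion I J f) (hν : IsOrientedUnitNormal oM oN f ν) (x : N) (k : ℕ)
    (w : Fin n → TangentSpace J x) :
    alphaForm cov oM (lift f ν hν.norm_eq_one x).1 (fun j : Fin n ↦
      (if (j : ℕ) < k then (mirror (lift f ν hν.norm_eq_one x).1).toLinearMap else LinearMap.id)
        (mfderiv J I.tangent (fun y ↦ (lift f ν hν.norm_eq_one y : TangentBundle I M)) x (w j))) =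
      (oN.orient x).volumeForm (fun j : Fin n ↦
        (if (j : ℕ) < k then LinearMap.id else -secondFundamentalForm J cov f ν x) (w j)) := by
  have hF : MDifferentiableAt J I.tangent
      (fun y ↦ (lift f ν hν.norm_eq_one y : TangentBundle I M)) x :=
    (contMDiff_unitNormal hf hν).mdifferentiableAt (by simp)
  rw [← volumeForm_cons_unitNormal hf hν]
  refine congrArg (oM.orient (f x)).volumeForm (funext fun j ↦ Fin.cases ?_ (fun j ↦ ?_) j)
  · have h1 : vertPart cov (lift f ν hν.norm_eq_one x).1
        (‖ν x‖⁻¹ • canonicalField (lift f ν hν.norm_eq_one x).1) = ν x := by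
      rw [hν.norm_eq_one, inv_one, one_smul]
      exact vertPart_vertLift cov _ _
    exact h1
  · by_cases hj : (j : ℕ) < k
    · simp only [Fin.cons_succ, hj, if_true]
      refine (vertPart_vertLift cov _ _).trans ?_
      exact dproj_mfderiv hF (w j)
    · simp only [Fin.cons_succ, hj, if_false]
      refine (vertPart_mfderiv cov hF (w j)).trans ?_
      exact (mfderiv_neg_secondFundamentalForm hcov hf hν x (w j)).symm

theorem pullbackForm_griffithsForm (hcov : IsLeviCivita cov)
    (hf : IsIsometricImmersion I J f) (hν : IsOrientedUnitNormal oM oN f ν) {i : ℕ} (hi : i ≤ n)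
    (x : N) :
    pullbackForm I J (lift f ν hν.norm_eq_one) (griffithsForm cov oM (n - i)) x =
      ((-1) ^ i * sigma i (secondFundamentalForm J cov f ν x)) • (oN.orient x).volumeForm := by
  have h := alternatization_compLinearMap_neg (Fact.out : finrank ℝ (TangentSpace J x) = n)
    (isSymmetric_secondFundamentalForm hcov hf hν x) (oN.orient x).volumeForm (Nat.sub_le n i)
  rw [Nat.sub_sub_self hi] at h
  rw [← h]
  ext v
  rw [pullbackForm, griffithsForm, AlternatingMap.compLinearMap_apply, AlternatingMap.smul_apply,
    AlternatingMap.smul_apply, Nat.sub_sub_self hi, MultilinearMap.alternatization_apply,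
    MultilinearMap.alternatization_apply]
  congr 1
  refine Finset.sum_congr rfl fun σ _ ↦ congrArg _ ?_
  exact alphaForm_mfderiv_lift hcov hf hν x (n - i) (fun j ↦ v (σ j))

end SecondFundamentalForm

end Griffiths

end

open Griffiths in
theorem mainTheorem9 {n : ℕ}
    {M : Type*} [TopologicalSpace M] [ChartedSpace (EuclideanSpace ℝ (Fin (n + 1))) M]
    [IsManifold (𝓡 (n + 1)) ∞ M]
    [RiemannianBundle (fun x : M ↦ TangentSpace (𝓡 (n + 1)) x)]
    [IsContMDiffRiemannianBundle (𝓡 (n + 1)) ∞ (EuclideanSpace ℝ (Fin (n + 1)))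
      (fun x : M ↦ TangentSpace (𝓡 (n + 1)) x)]
    (oM : ManifoldOrientation (𝓡 (n + 1)) M (n + 1))
    (cov : CovariantDerivative (𝓡 (n + 1)) (EuclideanSpace ℝ (Fin (n + 1)))
      (fun x : M ↦ TangentSpace (𝓡 (n + 1)) x))
    (hcov : IsLeviCivita cov)
    {E' : Type*} [NormedAddCommGroup E'] [NormedSpace ℝ E'] [FiniteDimensional ℝ E']
    [Fact (finrank ℝ E' = n)]
    {H' : Type*} [TopologicalSpace H'] (J : ModelWithCorners ℝ E' H')
    {N : Type*} [TopologicalSpace N] [ChartedSpace H' N] [IsManifold J ∞ N]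
    [RiemannianBundle (fun x : N ↦ TangentSpace J x)]
    [IsContMDiffRiemannianBundle J ∞ E' (fun x : N ↦ TangentSpace J x)]
    (oN : ManifoldOrientation J N n)
    (f : N → M) (hf : IsIsometricImmersion (𝓡 (n + 1)) J f)
    (ν : ∀ x : N, TangentSpace (𝓡 (n + 1)) (f x)) (hν : IsOrientedUnitNormal oM oN f ν) :
    ContMDiff J (𝓡 (n + 1)).tangent ∞
        (fun x ↦ (lift f ν hν.norm_eq_one x : TangentBundle (𝓡 (n + 1)) M)) ∧
      ∀ i : ℕ, i ≤ n → ∀ x : N,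
        pullbackForm (𝓡 (n + 1)) J (lift f ν hν.norm_eq_one) (griffithsForm cov oM (n - i)) x =
          ((-1) ^ i * sigma i (secondFundamentalForm J cov f ν x)) • (oN.orient x).volumeForm :=
  ⟨contMDiff_unitNormal hf hν, fun _ hi x ↦ pullbackForm_griffithsForm hcov hf hν hi x⟩
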